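/- Let $V$ be a real vector space of finite dimension $d$, let $\mathcal A$ be a finite set of affine hyperplanes in $V$, and fix linear coordinates on $V$. For $H\in\mathcal A$ choose an equation $\alpha(x)=c$ of $H$, with $0\ne\alpha\in V^*$ and $c\in\mathbb R$, and put $v_H=(\alpha,-c)\in V^*\times\mathbb R$. Let $M_{\mathcal A}$ be the matroid on $\{v_H : H\in\mathcal A\}$ given by linear independence (equivalently, the matroid of the normal vectors of the semicone of $\mathcal A$, which consists of the linear hyperplanes $\alpha(x)=cy$ in $V\times\mathbb R$). For a matroid $M$ on a set $E$, let its first Dilworth truncation $D_1M$ be the matroid on the set $\binom{E}{2}$ of $2$-element subsets of $E$ whose independent sets are the $I\subseteq\binom E2$ such that $$\operatorname{rank}_M\Bigl(\bigcup_{s\in I'}s\Bigr)\ \ge\ \#I'+1\qquad\text{for all } \emptyset\ne I'\subseteq I .$$ For a point $p$ lying on no hyperplane of $\mathcal A$, let the valid order arrangement $\mathrm{vo}(\mathcal A,p)$ consist of the affine spans $\mathrm{aff}(p,H\cap H')$ for all non-parallel $H,H'\in\mathcal A$, and of the hyperplanes through $p$ parallel to $H$ and $H'$ for all pairs of distinct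 parallel $H,H'\in\mathcal A$. Let $L_{\mathcal B}$ denote the intersection lattice of an arrangement $\mathcal B$ (all nonempty intersections of subsets of $\mathcal B$, including $V$ as the empty intersection, ordered by reverse inclusion), and let $L_M$ denote the lattice of flats of a matroid $M$, ordered by inclusion. Then for generic $p\in V$ one has $L_{\mathrm{vo}(\mathcal A,p)}\cong L_{D_1M_{\mathcal A}}$. That is, there is a nonzero real polynomial $f$ in $d$ variables, depending only on $\mathcal A$ (and the coordinates), such that for every $p\in V$ lying on no $H\in\mathcal A$ and with $f(p)\neq0$ the lattices $L_{\mathrm{vo}(\mathcal A,p)}$ and $L_{D_1M_{\mathcal A}}$ are isomorphic. -/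

import Mathlib

namespace ValidOrder

open Module

/-! ### The matroid of a set of vectors -/

/-- The matroid on a set `E` of vectors of a vector space, where independence is linear
independence. -/
def vectorMatroid (K : Type*) {W : Type*} [Field K] [AddCommGroup W] [Module K W] (E : Set W) :
    Matroid W :=
  (IndepMatroid.ofFinitaryCardAugment E (fun I => I ⊆ E ∧ LinearIndepOn K id I)
    ⟨Set.empty_subset _, linearIndepOn_empty K id⟩
    (fun _ _ hJ hIJ => ⟨hIJ.trans hJ.1, hJ.2.mono hIJ⟩)
    (by
      intro I J hI hIf hJ hJf hlt
      by_contra! hcon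
      have hsub : J ⊆ Submodule.span K I := by
        intro e he
        by_contra hes
        have heI : e ∉ I := fun h => hes (Submodule.subset_span h)
        exact hcon e he heI (Set.insert_subset (hJ.1 he) hI.1) (hI.2.id_insert hes)
      have hIfin := hIf.fintype
      have hJfin := hJf.fintype
      have : FiniteDimensional K (Submodule.span K I) := FiniteDimensional.span_of_finite K hIf
      have h1 := Submodule.finrank_mono (Submodule.span_le.2 hsub)
      rw [finrank_span_set_eq_card hI.2, finrank_span_set_eq_card hJ.2,
        ← Set.ncard_eq_toFinset_card', ← Set.ncard_eq_toFinset_card'] at h1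
      omega)
    (fun I h => ⟨fun e he => (h {e} (by simpa using he) (Set.finite_singleton e)).1 rfl,
      linearIndepOn_of_finite I fun t ht htf => (h t ht htf).2⟩)
    (fun _ h => h.1)).matroid

theorem vectorMatroid_ground {K W : Type*} [Field K] [AddCommGroup W] [Module K W] (E : Set W) :
    (vectorMatroid K E).E = E := rfl

theorem vectorMatroid_indep_iff {K W : Type*} [Field K] [AddCommGroup W] [Module K W]
    (E I : Set W) : (vectorMatroid K E).Indep I ↔ I ⊆ E ∧ LinearIndepOn K id I := Iff.rfl

/-! ### The Dilworth truncations of a matroid -/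

/-- The augmentation property of the set system attached to a monotone submodular function `g`
and a natural number `k`. -/
theorem exists_augment {β : Type*} [DecidableEq β] (g : Finset β → ℕ) (k : ℕ)
    (hmono : ∀ A B : Finset β, A ⊆ B → g A ≤ g B)
    (hsub : ∀ A B : Finset β, g (A ∪ B) + g (A ∩ B) ≤ g A + g B) (I J : Finset β)
    (hI : ∀ S ⊆ I, S.Nonempty → S.card + k ≤ g S)
    (hJ : ∀ S ⊆ J, S.Nonempty → S.card + k ≤ g S) (hlt : I.card < J.card) :
    ∃ e ∈ J, e ∉ I ∧ ∀ S ⊆ insert e I, S.Nonempty → S.card + k ≤ g S := by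
  classical
  by_contra! hcon
  let Tight : Finset β → Prop := fun T => T ⊆ I ∧ T.Nonempty ∧ g T = T.card + k
  let 𝒯 : Finset (Finset β) := I.powerset.filter fun T => Maximal Tight T
  have hmem : ∀ T, T ∈ 𝒯 ↔ Maximal Tight T := by
    intro T
    simp only [𝒯, Finset.mem_filter, Finset.mem_powerset, and_iff_right_iff_imp]
    exact fun h => h.prop.1
  have hext : ∀ T, Tight T → ∃ T' ∈ 𝒯, T ⊆ T' := by
    intro T hT
    have hfin : {S | Tight S}.Finite :=
      (Finset.finite_toSet I.powerset).subset fun S hS => by simpa using hS.1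
    obtain ⟨T', hTT', hT'⟩ := hfin.exists_le_maximal hT
    exact ⟨T', (hmem T').2 hT', hTT'⟩
  have hdisj : ∀ T ∈ 𝒯, ∀ T' ∈ 𝒯, T ≠ T' → Disjoint T T' := by
    intro T hT T' hT' hne
    rw [hmem] at hT hT'
    by_contra hd
    have hne' : (T ∩ T').Nonempty := Finset.not_disjoint_iff_nonempty_inter.1 hd
    have hU : Tight (T ∪ T') := by
      refine ⟨Finset.union_subset hT.prop.1 hT'.prop.1, hT.prop.2.1.mono Finset.subset_union_left,
        ?_⟩
      have h1 := hsub T T'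
      have h2 := hI (T ∩ T') (Finset.inter_subset_left.trans hT.prop.1) hne'
      have h3 := hI (T ∪ T') (Finset.union_subset hT.prop.1 hT'.prop.1)
        (hT.prop.2.1.mono Finset.subset_union_left)
      have h4 := Finset.card_union_add_card_inter T T'
      have h5 := hT.prop.2.2
      have h6 := hT'.prop.2.2
      omega
    have e1 := hT.eq_of_le hU Finset.subset_union_left
    have e2 := hT'.eq_of_le hU Finset.subset_union_right
    exact hne (e1.trans e2.symm)
  let F : Finset β → Finset β := fun T => J.filter fun e => g (insert e T) = g T
  have hF : ∀ T ∈ 𝒯, (F T).card ≤ T.card := by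
    intro T hT
    rw [hmem] at hT
    rcases (F T).eq_empty_or_nonempty with h0 | h0
    · simp [h0]
    · have key : ∀ S : Finset β, S ⊆ F T → g (T ∪ S) = g T := by
        intro S
        induction S using Finset.induction_on with
        | empty => simp
        | insert a S ha ih =>
          intro hS
          have h1 := ih ((Finset.subset_insert a S).trans hS)
          have h2 : g (insert a T) = g T :=
            (Finset.mem_filter.1 (hS (Finset.mem_insert_self a S))).2
          have h3 := hsub (T ∪ S) (insert a T)
          have h4 : (T ∪ S) ∪ insert a T = T ∪ insert a S := by
            ext x; simp only [Finset.mem_union, Finset.mem_insert]; tauto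
          have h5 := hmono T ((T ∪ S) ∩ insert a T)
            (Finset.subset_inter Finset.subset_union_left (Finset.subset_insert a T))
          have h6 := hmono T (T ∪ insert a S) Finset.subset_union_left
          rw [h4] at h3
          omega
      have h1 := key (F T) subset_rfl
      have h2 := hJ (F T) (Finset.filter_subset _ _) h0
      have h3 := hmono (F T) (T ∪ F T) Finset.subset_union_right
      have h4 := hT.prop.2.2
      omega
  have hcover : J ⊆ 𝒯.biUnion F ∪ (I \ 𝒯.biUnion id) := by
    intro e he
    by_cases heI : e ∈ I
    · by_cases heT : e ∈ 𝒯.biUnion id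
      · obtain ⟨T, hT, heT⟩ := Finset.mem_biUnion.1 heT
        refine Finset.mem_union_left _ (Finset.mem_biUnion.2 ⟨T, hT, Finset.mem_filter.2 ⟨he, ?_⟩⟩)
        rw [Finset.insert_eq_of_mem (show e ∈ T from heT)]
      · exact Finset.mem_union_right _ (Finset.mem_sdiff.2 ⟨heI, heT⟩)
    · obtain ⟨S, hS, hSne, hSlt⟩ := hcon e he heI
      have heS : e ∈ S := by
        by_contra heS
        have := hI S ((Finset.subset_insert_iff_of_notMem heS).1 hS) hSne
        omega
      have hsubI : S.erase e ⊆ I := Finset.subset_insert_iff.1 hS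
      have hcard := Finset.card_erase_add_one heS
      have hne : (S.erase e).Nonempty := by
        by_contra hne
        rw [Finset.not_nonempty_iff_eq_empty] at hne
        have hSe : S ⊆ {e} := by
          intro x hx
          by_contra hxe
          have : x ∈ S.erase e := Finset.mem_erase.2 ⟨by simpa using hxe, hx⟩
          simp [hne] at this
        have := hJ S (hSe.trans (by simpa using he)) hSne
        omega
      have h1 := hI _ hsubI hne
      have h2 := hmono _ _ (Finset.erase_subset e S)
      obtain ⟨T, hT, hST⟩ := hext (S.erase e) ⟨hsubI, hne, by omega⟩
      refine Finset.mem_union_left _ (Finset.mem_biUnion.2 ⟨T, hT, Finset.mem_filter.2 ⟨he, ?_⟩⟩)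
      have h3 := hsub S T
      have h4 := hmono (S.erase e) (S ∩ T) (Finset.subset_inter (Finset.erase_subset e S) hST)
      have h5 := hmono T (insert e T) (Finset.subset_insert e T)
      have h6 := hmono (insert e T) (S ∪ T)
        (Finset.insert_subset (Finset.mem_union_left _ heS) Finset.subset_union_right)
      omega
  have h1 := Finset.card_le_card hcover
  have h2 := Finset.card_union_le (𝒯.biUnion F) (I \ 𝒯.biUnion id)
  have h3 : (𝒯.biUnion F).card ≤ ∑ T ∈ 𝒯, T.card :=
    Finset.card_biUnion_le.trans (Finset.sum_le_sum hF)
  have h4 : (𝒯.biUnion id).card = ∑ T ∈ 𝒯, T.card :=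
    Finset.card_biUnion fun T hT T' hT' hne => hdisj T hT T' hT' hne
  have h5 : 𝒯.biUnion id ⊆ I := by
    intro x hx
    obtain ⟨T, hT, hxT⟩ := Finset.mem_biUnion.1 hx
    exact ((hmem T).1 hT).prop.1 hxT
  have h6 := Finset.card_sdiff_add_card_eq_card h5
  omega

/-- Independence in the `k`-th Dilworth truncation of `M`: a set `I` of `(k+1)`-element subsets of
the ground set of `M` is independent if `rank (⋃ I') ≥ #I' + k` for every nonempty (finite)
`I' ⊆ I`. -/
def DilworthIndep {α : Type*} (M : Matroid α) (k : ℕ) (I : Set (Finset α)) : Prop :=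
  I ⊆ {s : Finset α | (s : Set α) ⊆ M.E ∧ s.card = k + 1} ∧
    ∀ I' : Finset (Finset α), (I' : Set (Finset α)) ⊆ I → I'.Nonempty →
      ((I'.card + k : ℕ) : ℕ∞) ≤ M.eRk (⋃ s ∈ I', (s : Set α))

/-- The `k`-th Dilworth truncation `D_k M`, a matroid on the set of `(k+1)`-element subsets of the
ground set of `M`. -/
def dilworthTruncation {α : Type*} (k : ℕ) (M : Matroid α) : Matroid (Finset α) :=
  (IndepMatroid.ofFinitaryCardAugment {s : Finset α | (s : Set α) ⊆ M.E ∧ s.card = k + 1}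
    (DilworthIndep M k)
    ⟨Set.empty_subset _, fun I' h hne => by
      rw [Set.subset_empty_iff, Finset.coe_eq_empty] at h
      exact absurd h hne.ne_empty⟩
    (fun _ _ hJ hIJ => ⟨hIJ.trans hJ.1, fun I' h => hJ.2 I' (h.trans hIJ)⟩)
    (by
      classical
      intro I J hI hIf hJ hJf hlt
      let U : Finset (Finset α) → Set α := fun S => ⋃ s ∈ S, (s : Set α)
      have hUmono : ∀ A B : Finset (Finset α), A ⊆ B → U A ⊆ U B := fun A B h =>
        Set.biUnion_subset_biUnion_left h
      have hfin : ∀ S, M.eRk (U S) ≠ ⊤ := by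
        intro S
        have : (U S).Finite := S.finite_toSet.biUnion fun s _ => s.finite_toSet
        exact ((M.eRk_le_encard _).trans_lt this.encard_lt_top).ne
      let g : Finset (Finset α) → ℕ := fun S => (M.eRk (U S)).toNat
      have hg : ∀ S, (g S : ℕ∞) = M.eRk (U S) := fun S => ENat.natCast_toNat (hfin S)
      have hle : ∀ (n : ℕ) S, n ≤ g S ↔ (n : ℕ∞) ≤ M.eRk (U S) := fun n S => by
        rw [← hg, Nat.cast_le]
      have hI' : ∀ S ⊆ hIf.toFinset, S.Nonempty → S.card + k ≤ g S := fun S hS hne =>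
        (hle _ _).2 (hI.2 S (fun x hx => hIf.mem_toFinset.1 (hS hx)) hne)
      have hJ' : ∀ S ⊆ hJf.toFinset, S.Nonempty → S.card + k ≤ g S := fun S hS hne =>
        (hle _ _).2 (hJ.2 S (fun x hx => hJf.mem_toFinset.1 (hS hx)) hne)
      obtain ⟨e, heJ, heI, he⟩ := exists_augment g k
        (fun A B h => by
          rw [hle, hg]
          exact M.eRk_mono (hUmono A B h))
        (fun A B => by
          have h1 : U (A ∪ B) ⊆ U A ∪ U B := by
            intro x hx
            simp only [U, Set.mem_iUnion, Set.mem_union, Finset.mem_union] at hx ⊢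
            obtain ⟨s, hs | hs, hx⟩ := hx
            · exact Or.inl ⟨s, hs, hx⟩
            · exact Or.inr ⟨s, hs, hx⟩
          have h2 : U (A ∩ B) ⊆ U A ∩ U B := Set.subset_inter
            (hUmono _ _ Finset.inter_subset_left) (hUmono _ _ Finset.inter_subset_right)
          have h3 := M.eRk_inter_add_eRk_union_le (U A) (U B)
          have h4 := (add_le_add (M.eRk_mono h2) (M.eRk_mono h1)).trans h3
          rw [← hg, ← hg, ← hg, ← hg] at h4
          have h5 : g (A ∩ B) + g (A ∪ B) ≤ g A + g B := by exact_mod_cast h4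
          omega)
        hIf.toFinset hJf.toFinset hI' hJ'
        (by rwa [← Set.ncard_eq_toFinset_card I hIf, ← Set.ncard_eq_toFinset_card J hJf])
      rw [hJf.mem_toFinset] at heJ
      rw [hIf.mem_toFinset] at heI
      refine ⟨e, heJ, heI, Set.insert_subset (hJ.1 heJ) hI.1, fun I' h hne => ?_⟩
      refine (hle _ _).1 (he I' (fun x hx => ?_) hne)
      simpa using h hx)
    (fun I h => ⟨fun e he => (h {e} (by simpa using he) (Set.finite_singleton e)).1 rfl,
      fun I' hI' hne => (h I' hI' I'.finite_toSet).2 I' subset_rfl hne⟩)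
    (fun _ h => h.1)).matroid

theorem dilworthTruncation_ground {α : Type*} (k : ℕ) (M : Matroid α) :
    (dilworthTruncation k M).E = {s : Finset α | (s : Set α) ⊆ M.E ∧ s.card = k + 1} := rfl

theorem dilworthTruncation_indep_iff {α : Type*} (k : ℕ) (M : Matroid α) (I : Set (Finset α)) :
    (dilworthTruncation k M).Indep I ↔ DilworthIndep M k I := Iff.rfl

/-- The lattice of flats of a matroid, ordered by inclusion. -/
abbrev FlatLattice {α : Type*} (M : Matroid α) : Type _ := {F : Set α // M.IsFlat F}

/-! ### Hyperplane arrangements -/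

section Arrangement

variable {V : Type*} [AddCommGroup V] [Module ℝ V]

/-- `v = (α, -c)` is the vector of an equation `α x = c`, `α ≠ 0`, of `H`. -/
def IsEquationVector (H : AffineSubspace ℝ V) (v : Dual ℝ V × ℝ) : Prop :=
  ∃ (α : Dual ℝ V) (c : ℝ), α ≠ 0 ∧ (H : Set V) = {x | α x = c} ∧ v = (α, -c)

/-- An affine hyperplane: the solution set of an equation `α x = c` with `α ≠ 0`. -/
def IsHyperplane (H : AffineSubspace ℝ V) : Prop :=
  ∃ (α : Dual ℝ V) (c : ℝ), α ≠ 0 ∧ (H : Set V) = {x | α x = c}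

open Classical in
/-- The vector `v_H = (α, -c)` of a chosen equation `α x = c` of the hyperplane `H` (determined up
to a nonzero scalar; the value is `0` if `H` is not a hyperplane). -/
noncomputable def equationVector (H : AffineSubspace ℝ V) : Dual ℝ V × ℝ :=
  if h : ∃ v, IsEquationVector H v then h.choose else 0

theorem isEquationVector_equationVector {H : AffineSubspace ℝ V} (hH : IsHyperplane H) :
    IsEquationVector H (equationVector H) := by
  obtain ⟨α, c, h0, hH⟩ := hH
  have h : ∃ v, IsEquationVector H v := ⟨(α, -c), α, c, h0, hH, rfl⟩
  rw [equationVector, dif_pos h]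
  exact h.choose_spec

/-- The matroid `M_𝒜` of an arrangement: the matroid of the vectors `v_H`, `H ∈ 𝒜`, that is, of
the normal vectors of the hyperplanes `α x = c y` of the semicone of `𝒜` in `V × ℝ`. -/
noncomputable def arrangementMatroid (𝒜 : Set (AffineSubspace ℝ V)) : Matroid (Dual ℝ V × ℝ) :=
  vectorMatroid ℝ (equationVector '' 𝒜)

/-- The valid order arrangement `vo(𝒜, p)`: the hyperplanes `aff(p, H ∩ H')` for non-parallel
`H, H' ∈ 𝒜`, and the hyperplanes through `p` parallel to two distinct parallel `H, H' ∈ 𝒜`. -/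
def validOrderArrangement (𝒜 : Set (AffineSubspace ℝ V)) (p : V) : Set (AffineSubspace ℝ V) :=
  {K | ∃ H ∈ 𝒜, ∃ H' ∈ 𝒜, ¬ H.Parallel H' ∧
    K = affineSpan ℝ (insert p ((H : Set V) ∩ (H' : Set V)))} ∪
  {K | ∃ H ∈ 𝒜, ∃ H' ∈ 𝒜, H ≠ H' ∧ H.Parallel H' ∧ K = AffineSubspace.mk' p H.direction}

/-- The intersection lattice (in general, poset) of an arrangement: all nonempty intersections of
subsets of the arrangement, including the whole space as the empty intersection, ordered by
reverse inclusion. -/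
abbrev IntersectionLattice (ℬ : Set (AffineSubspace ℝ V)) : Type _ :=
  {X : AffineSubspace ℝ V // (X : Set V).Nonempty ∧ ∃ 𝒞 ⊆ ℬ, X = sInf 𝒞}ᵒᵈ

end Arrangement

end ValidOrder

/-!
The vector `v_H = (α, -c)` of a hyperplane `α x = c` stands for the affine function `x ↦ α x - c` on
`V`, and evaluation at `p` is a functional `evalEquation p` on `V* × ℝ`. For two distinct
hyperplanes `H`, `H'`, the combination of `v_H` and `v_{H'}` that vanishes at `p`, that is, the
point in which the line through `v_H` and `v_{H'}` meets the hyperplane `evalEquation p = 0` of `V*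
× ℝ`, is an equation of the member of the valid order arrangement given by `H` and `H'`, parallel or
not (`validOrderArrangement_eq`). All these members pass through `p`, so their intersection lattice
is the lattice of flats of the matroid represented by the linear parts of these equations
(`IsRepresentation.nonempty_intersectionLattice_orderIso`). It remains to see that for generic `p`
this matroid is the first Dilworth truncation, which is Lovász's theorem on generic hyperplane
sections.

Independent section points of a set of pairs lie in the span of the pairs and in the hyperplane
`evalEquation p = 0`, which does not contain this span; this gives the rank condition of the
Dilworth truncation (`card_add_one_le_finrank_of_linearIndepOn`). Conversely, if a set of pairs
satisfies the rank condition, then some functional on `V* × ℝ` has independent section points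
(`exists_functional_linearIndepOn`); it can be taken nonzero at `(0, 1)`, so that it is a multiple
of the evaluation at a point. Independence of the section points is the nonvanishing of a Gram
determinant, a polynomial in `p` (`exists_mvPolynomial_linearIndepOn_iff`), and the product of these
polynomials over the finitely many independent sets of the Dilworth truncation is the required
polynomial.
-/

namespace ValidOrder

open Module

/-! ### Generic functionals -/

/-- The generic point `a + t • b` of the line through two points of a projective space avoids any
finite family of subspaces not containing the line. -/
theorem exists_add_smul_notMem {K W : Type*} [Field K] [Infinite K] [AddCommGroup W] [Module K W]
    {a b : W} {𝒰 : Set (Submodule K W)} (hfin : 𝒰.Finite) (h𝒰 : ∀ U ∈ 𝒰, a ∈ U → b ∉ U) :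
    ∃ t : K, ∀ U ∈ 𝒰, a + t • b ∉ U := by
  have hbad : (⋃ U ∈ 𝒰, {t : K | a + t • b ∈ U}).Finite := by
    refine hfin.biUnion fun U hU => Set.Subsingleton.finite fun t ht t' ht' => ?_
    by_contra hne
    have hb : b ∈ U := by
      have h := U.sub_mem ht ht'
      rw [add_sub_add_left_eq_sub, ← sub_smul] at h
      exact (U.smul_mem_iff (sub_ne_zero.2 hne)).1 h
    exact h𝒰 U hU ((U.add_mem_iff_left (U.smul_mem t hb)).1 ht) hb
  obtain ⟨t, ht⟩ := hbad.infinite_compl.nonempty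
  exact ⟨t, fun U hU h => ht (Set.mem_biUnion hU h)⟩

theorem finrank_map_mkQ_add_finrank_inf {K W : Type*} [Field K] [AddCommGroup W] [Module K W]
    (U L : Submodule K W) [FiniteDimensional K U] :
    finrank K (U.map L.mkQ) + finrank K (U ⊓ L : Submodule K W) = finrank K U := by
  have h := LinearMap.finrank_range_add_finrank_ker (L.mkQ.domRestrict U)
  have h1 : LinearMap.ker (L.mkQ.domRestrict U) = L.comap U.subtype := by
    ext x
    simp
  rwa [LinearMap.range_domRestrict, h1, ← Submodule.finrank_map_subtype_eq,
    Submodule.map_comap_subtype] at h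

/-- For a functional `φ`, the point `φ(b) a - φ(a) b` of the line through `a` and `b` at which `φ`
vanishes. -/
def sectionPoint {K W : Type*} [Field K] [AddCommGroup W] [Module K W] (φ : Dual K W) (a b : W) :
    W :=
  φ b • a - φ a • b

/-- Lovász's theorem on generic hyperplane sections of lines: suppose that any `n ≥ 1` of the
pairs `{a i, b i}` span a space of dimension at least `n + 1`. Then the points where a suitable
hyperplane `φ = 0` meets the lines spanned by the pairs are linearly independent, and `φ` can be
chosen to be nonzero on given nonzero vectors.

The induction is on the number of pairs: the point `w = a + t • b` of one line, for generic `t`, is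
put into the hyperplane, and the quotient by `w` inherits the rank condition: the rank of `S` drops
only if `w` lies in the span of `S`, and then so does the whole line, whose pair could be added to
`S` without changing the span. -/
theorem exists_functional_linearIndepOn {K ι : Type*} [Field K] [Infinite K] [DecidableEq ι]
    (I : Finset ι) : ∀ {W : Type*} [AddCommGroup W] [Module K W] (a b : ι → W) (F : Set W),
    F.Finite → (∀ w ∈ F, w ≠ 0) →
    (∀ S ⊆ I, S.Nonempty → S.card + 1 ≤ finrank K (Submodule.span K (⋃ i ∈ S, {a i, b i}))) →
    ∃ φ : Dual K W, (∀ w ∈ F, φ w ≠ 0) ∧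
      LinearIndepOn K (fun i => sectionPoint φ (a i) (b i)) (I : Set ι) := by
  simp only [sectionPoint]
  induction I using Finset.induction_on with
  | empty =>
    intro W _ _ a b F hF hF0 _
    have := hF.to_subtype
    obtain ⟨φ, hφ⟩ := exists_dual_forall_apply_ne_zero (K := K) (fun w : F => (w : W))
      fun w => hF0 w w.2
    exact ⟨φ, fun w hw => hφ ⟨w, hw⟩, by simp⟩
  | insert j I hj ih =>
    intro W _ _ a b F hF hF0 hrank
    let span' : Finset ι → Submodule K W := fun S => Submodule.span K (⋃ i ∈ S, {a i, b i})
    have hfd : ∀ S, FiniteDimensional K (span' S) := fun S =>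
      FiniteDimensional.span_of_finite K (S.finite_toSet.biUnion fun i _ => by simp)
    -- a one-dimensional space cannot contain the line spanned by the pair `j`
    have hline : ∀ f : W, a j ∈ K ∙ f → b j ∉ K ∙ f := by
      intro f ha hb
      have h1 := hrank {j} (by simp) (by simp)
      have h2 : Submodule.span K (⋃ i ∈ ({j} : Finset ι), {a i, b i}) ≤ K ∙ f := by
        rw [Submodule.span_le]
        simp [Set.insert_subset_iff, ha, hb]
      have h3 := (Submodule.finrank_mono h2).trans (finrank_span_le_card {f})
      simp at h1 h3
      omega
    have hbj : b j ≠ 0 := fun h => hline (a j) (Submodule.mem_span_singleton_self _) (by simp [h])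
    obtain ⟨t, ht⟩ := exists_add_smul_notMem (K := K) (a := a j) (b := b j)
      (𝒰 := (fun f => K ∙ f) '' insert (b j) F ∪
        {U | U ∈ span' '' (I.powerset : Set (Finset ι)) ∧ (a j ∈ U → b j ∉ U)})
      (((hF.insert _).image _).union
        (((Finset.finite_toSet _).image _).subset fun U hU => hU.1))
      (by
        rintro U (⟨f, _, rfl⟩ | hU)
        · exact hline f
        · exact hU.2)
    obtain ⟨w, hw⟩ : ∃ w, a j + t • b j = w := ⟨_, rfl⟩
    rw [hw] at ht
    have hwF : ∀ f ∈ insert (b j) F, w ∉ K ∙ f := fun f hf => ht _ (Or.inl ⟨f, hf, rfl⟩)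
    have hwS : ∀ S ⊆ I, w ∈ span' S → a j ∈ span' S ∧ b j ∈ span' S := by
      intro S hS hwS
      by_contra! hcon
      exact ht _ (Or.inr ⟨⟨S, by simpa using hS, rfl⟩, hcon⟩) hwS
    have hw0 : w ≠ 0 := fun h => hwF _ (Set.mem_insert _ _) (h ▸ Submodule.zero_mem _)
    obtain ⟨ψ, hψF, hψ⟩ := ih (W := W ⧸ (K ∙ w)) (fun i => (K ∙ w).mkQ (a i))
      (fun i => (K ∙ w).mkQ (b i)) ((K ∙ w).mkQ '' insert (b j) F) ((hF.insert _).image _)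
      (by
        rintro _ ⟨f, hf, rfl⟩ h
        rw [Submodule.mkQ_apply, Submodule.Quotient.mk_eq_zero,
          Submodule.mem_span_singleton] at h
        obtain ⟨c, rfl⟩ := h
        have hc : c ≠ 0 := by
          rintro rfl
          rcases hf with hf | hf
          · exact hbj (by rw [← hf, zero_smul])
          · exact hF0 _ hf (zero_smul _ _)
        refine hwF _ hf (Submodule.mem_span_singleton.2 ⟨c⁻¹, inv_smul_smul₀ hc w⟩))
      (by
        intro S hS hne
        have himage : (⋃ i ∈ S, {(K ∙ w).mkQ (a i), (K ∙ w).mkQ (b i)}) =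
            (K ∙ w).mkQ '' ⋃ i ∈ S, {a i, b i} := by
          simp only [Set.image_iUnion, Set.image_insert_eq, Set.image_singleton]
        rw [himage, Submodule.span_image]
        have h1 := hrank S (hS.trans (Finset.subset_insert _ _)) hne
        have hfd' := hfd S
        have h2 := finrank_map_mkQ_add_finrank_inf (span' S) (K ∙ w)
        by_cases hwS' : w ∈ span' S
        · obtain ⟨ha, hb⟩ := hwS S hS hwS'
          have h3 := hrank (insert j S) (Finset.insert_subset_insert j hS) (by simp)
          rw [Finset.card_insert_of_notMem fun h => hj (hS h)] at h3
          have h4 : Submodule.span K (⋃ i ∈ insert j S, {a i, b i}) ≤ span' S := by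
            rw [Submodule.span_le, Finset.set_biUnion_insert, Set.union_subset_iff]
            exact ⟨Set.insert_subset ha (Set.singleton_subset_iff.2 hb), Submodule.subset_span⟩
          have h5 := Submodule.finrank_mono h4
          have h6 := (Submodule.finrank_mono (inf_le_right : span' S ⊓ (K ∙ w) ≤ K ∙ w)).trans
            (finrank_span_le_card {w})
          rw [Set.toFinset_singleton, Finset.card_singleton] at h6
          simp only [span'] at h2 h5 h6
          omega
        · rw [(Submodule.disjoint_span_singleton_of_notMem hwS').eq_bot, finrank_bot] at h2
          simp only [span'] at h2
          omega)
    obtain ⟨φ, hφ⟩ : ∃ φ : Dual K W, φ = ψ ∘ₗ (K ∙ w).mkQ := ⟨_, rfl⟩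
    have hφ' : ∀ x, ψ ((K ∙ w).mkQ x) = φ x := fun x => by rw [hφ, LinearMap.comp_apply]
    have hφw : φ w = 0 := by
      rw [← hφ', Submodule.mkQ_apply,
        (Submodule.Quotient.mk_eq_zero _).2 (Submodule.mem_span_singleton_self w), map_zero]
    have hφF : ∀ f ∈ insert (b j) F, φ f ≠ 0 := fun f hf => hφ' f ▸ hψF _ ⟨f, hf, rfl⟩
    have hφb := hφF _ (Set.mem_insert _ _)
    -- the hyperplane `φ = 0` meets the line of the pair `j` in the point `w`
    have hpt : φ (b j) • a j - φ (a j) • b j = φ (b j) • w := by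
      rw [← hw, map_add, map_smul, smul_eq_mul] at hφw
      rw [eq_neg_of_add_eq_zero_left hφw, ← hw]
      module
    refine ⟨φ, fun f hf => hφF f (Set.mem_insert_of_mem _ hf), ?_⟩
    have hspan : Submodule.span K ((fun i => φ (b i) • a i - φ (a i) • b i) '' {j}) = K ∙ w := by
      rw [Set.image_singleton, hpt]
      exact Submodule.span_singleton_smul_eq (IsUnit.mk0 _ hφb) w
    rw [Finset.coe_insert, ← Set.singleton_union]
    refine LinearIndepOn.union_of_quotient (.singleton ?_) ?_
    · rw [hpt]
      exact smul_ne_zero hφb hw0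
    · rw [hspan]
      refine hψ.congr fun i _ => ?_
      simp only [hφ', Function.comp_apply, map_sub, map_smul]

/-! ### Represented matroids -/

/-- The vectors `γ e` represent the matroid `M` over `K`: independence in `M` is linear
independence of the (indexed) family `γ`. -/
def IsRepresentation (K : Type*) {W α : Type*} [Field K] [AddCommGroup W] [Module K W]
    (M : Matroid α) (γ : α → W) : Prop :=
  ∀ I, M.Indep I ↔ I ⊆ M.E ∧ LinearIndepOn K γ I

theorem isRepresentation_vectorMatroid {K W : Type*} [Field K] [AddCommGroup W] [Module K W]
    (E : Set W) : IsRepresentation K (vectorMatroid K E) id :=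
  vectorMatroid_indep_iff E

section Representation

variable {K W α : Type*} [Field K] [AddCommGroup W] [Module K W] {M : Matroid α} {γ : α → W}

theorem IsRepresentation.mem_closure_indep_iff (h : IsRepresentation K M γ) {I : Set α}
    (hI : M.Indep I) {e : α} (he : e ∈ M.E) :
    e ∈ M.closure I ↔ γ e ∈ Submodule.span K (γ '' I) := by
  rw [hI.mem_closure_iff', h, linearIndepOn_insert_iff]
  have h1 := (h I).1 hI
  have h2 : e ∈ I → γ e ∈ Submodule.span K (γ '' I) := fun h =>
    Submodule.subset_span (Set.mem_image_of_mem γ h)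
  have h3 := Set.insert_subset he h1.1
  tauto

theorem IsRepresentation.span_image_eq (h : IsRepresentation K M γ) {I X : Set α}
    (hI : M.IsBasis I X) : Submodule.span K (γ '' I) = Submodule.span K (γ '' X) := by
  refine le_antisymm (Submodule.span_mono (Set.image_mono hI.subset)) (Submodule.span_le.2 ?_)
  rintro _ ⟨e, he, rfl⟩
  exact (h.mem_closure_indep_iff hI.indep (hI.subset_ground he)).1 (hI.subset_closure he)

theorem IsRepresentation.mem_closure_iff (h : IsRepresentation K M γ) {X : Set α} (hX : X ⊆ M.E)
    {e : α} (he : e ∈ M.E) : e ∈ M.closure X ↔ γ e ∈ Submodule.span K (γ '' X) := by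
  obtain ⟨I, hI⟩ := M.exists_isBasis X
  rw [← hI.closure_eq_closure, h.mem_closure_indep_iff hI.indep he, h.span_image_eq hI]

theorem IsRepresentation.isFlat_iff (h : IsRepresentation K M γ) {F : Set α} :
    M.IsFlat F ↔ F ⊆ M.E ∧ ∀ e ∈ M.E, γ e ∈ Submodule.span K (γ '' F) → e ∈ F := by
  constructor
  · intro hF
    refine ⟨hF.subset_ground, fun e he heF => ?_⟩
    rwa [← h.mem_closure_iff hF.subset_ground he, hF.closure] at heF
  · rintro ⟨hFE, hF⟩
    rw [Matroid.isFlat_iff_closure_eq]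
    refine (M.subset_closure F).antisymm' fun e he => ?_
    have heE := M.closure_subset_ground F he
    exact hF e heE ((h.mem_closure_iff hFE heE).1 he)

theorem IsRepresentation.eRk_eq_finrank (h : IsRepresentation K M γ) {X : Set α} (hX : X ⊆ M.E)
    (hfin : X.Finite) : M.eRk X = finrank K (Submodule.span K (γ '' X)) := by
  obtain ⟨I, hI⟩ := M.exists_isBasis X
  have hIfin := hfin.subset hI.subset
  have := hIfin.fintype
  have hli : LinearIndependent K fun e : I => γ e := ((h I).1 hI.indep).2
  rw [hI.eRk_eq_encard, ← h.span_image_eq hI, Set.image_eq_range, finrank_span_eq_card hli,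
    ← Set.coe_fintypeCard]

end Representation

/-- The intersections of hyperplanes through a common point `p` are determined by the subspaces
spanned by the linear parts of their equations, so they form the lattice of flats of the matroid
represented by these linear parts. -/
theorem IsRepresentation.nonempty_intersectionLattice_orderIso {V α : Type*} [AddCommGroup V]
    [Module ℝ V] [FiniteDimensional ℝ V] {M : Matroid α} {γ : α → Dual ℝ V}
    (h : IsRepresentation ℝ M γ) (p : V) :
    Nonempty (IntersectionLattice
      ((fun e => AffineSubspace.mk' p (LinearMap.ker (γ e))) '' M.E) ≃o FlatLattice M) := by
  let κ : α → AffineSubspace ℝ V := fun e => AffineSubspace.mk' p (LinearMap.ker (γ e))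
  have hκ : ∀ e x, x ∈ κ e ↔ γ e (x - p) = 0 := fun e x => by
    simp [κ, AffineSubspace.mem_mk']
  have hmem : ∀ (𝒞 : Set (AffineSubspace ℝ V)) x, x ∈ sInf 𝒞 ↔ ∀ C ∈ 𝒞, x ∈ C := fun 𝒞 x => by
    rw [← SetLike.mem_coe, AffineSubspace.coe_sInf]
    simp
  have hInf : ∀ F x, x ∈ sInf (κ '' F) ↔ ∀ e ∈ F, γ e (x - p) = 0 := fun F x => by
    simp [hmem, hκ]
  let Φ : FlatLattice M → IntersectionLattice (κ '' M.E) := fun F =>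
    OrderDual.toDual ⟨sInf (κ '' F.1), ⟨p, (hInf _ _).2 fun e _ => by simp⟩, κ '' F.1,
      Set.image_mono F.2.subset_ground, rfl⟩
  have hΦ : ∀ F F', Φ F ≤ Φ F' ↔ F ≤ F' := by
    intro F F'
    change sInf (κ '' F'.1) ≤ sInf (κ '' F.1) ↔ F.1 ⊆ F'.1
    refine ⟨fun hle e he => ?_, fun hle => sInf_le_sInf (Set.image_mono hle)⟩
    refine (h.isFlat_iff.1 F'.2).2 e (F.2.subset_ground he) ?_
    rw [Set.image_eq_range]
    refine FiniteDimensional.mem_span_of_iInf_ker_le_ker fun x hx => ?_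
    have hx' : x + p ∈ sInf (κ '' F'.1) := (hInf _ _).2 fun e' he' => by
      simpa using (Submodule.mem_iInf _).1 hx ⟨e', he'⟩
    simpa using (hInf _ _).1 (hle hx') e he
  refine ⟨(RelIso.ofSurjective (OrderEmbedding.ofMapLEIff Φ hΦ) fun X => ?_).symm⟩
  obtain ⟨X, hne, 𝒞, h𝒞, rfl⟩ := X
  -- the flat of an intersection consists of all the hyperplanes containing it
  have hflat : M.IsFlat {e ∈ M.E | sInf 𝒞 ≤ κ e} := by
    refine h.isFlat_iff.2 ⟨fun e he => he.1, fun e he hspan => ⟨he, fun x hx => (hκ e x).2 ?_⟩⟩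
    have : Submodule.span ℝ (γ '' {e ∈ M.E | sInf 𝒞 ≤ κ e}) ≤
        LinearMap.ker (Dual.eval ℝ V (x - p)) := by
      rw [Submodule.span_le]
      rintro _ ⟨e', he', rfl⟩
      exact (hκ e' x).1 (he'.2 hx)
    exact this hspan
  refine ⟨⟨_, hflat⟩, congrArg OrderDual.toDual (Subtype.ext (le_antisymm ?_ ?_))⟩
  · refine le_sInf fun C hC => ?_
    obtain ⟨e, he, rfl⟩ := h𝒞 hC
    exact sInf_le ⟨e, ⟨he, sInf_le hC⟩, rfl⟩
  · refine le_sInf ?_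
    rintro _ ⟨e, he, rfl⟩
    exact he.2

/-! ### Sections by the hyperplane of a point -/

theorem apply_sectionPoint {K W : Type*} [Field K] [AddCommGroup W] [Module K W] (φ : Dual K W)
    (a b : W) : φ (sectionPoint φ a b) = 0 := by
  simp [sectionPoint, mul_comm]

/-- Necessity of the rank condition in the Dilworth truncation: independent section points of the
pairs in `S` lie in a proper subspace of the span of `S`. -/
theorem card_add_one_le_finrank_of_linearIndepOn {K W ι : Type*} [Field K] [AddCommGroup W]
    [Module K W] {φ : Dual K W} {a b : ι → W} {S : Finset ι} (hS : S.Nonempty)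
    (hφ : ∀ i ∈ S, φ (a i) ≠ 0)
    (hli : LinearIndepOn K (fun i => sectionPoint φ (a i) (b i)) (S : Set ι)) :
    S.card + 1 ≤ finrank K (Submodule.span K (⋃ i ∈ S, {a i, b i})) := by
  set U := Submodule.span K (⋃ i ∈ S, {a i, b i}) with hU
  have : FiniteDimensional K U :=
    FiniteDimensional.span_of_finite K (S.finite_toSet.biUnion fun i _ => by simp)
  have hmem : ∀ i ∈ S, a i ∈ U ∧ b i ∈ U := fun i hi =>
    ⟨Submodule.subset_span (Set.mem_biUnion hi (by simp)),
      Submodule.subset_span (Set.mem_biUnion hi (by simp))⟩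
  obtain ⟨i₀, hi₀⟩ := hS
  have hlt : U ⊓ LinearMap.ker φ < U := by
    refine lt_of_le_of_ne inf_le_left fun h => hφ i₀ hi₀ ?_
    exact (inf_eq_left.1 h) (hmem i₀ hi₀).1
  have h1 := Submodule.finrank_lt_finrank_of_lt hlt
  have h2 : Submodule.span K (Set.range fun i : (S : Set ι) => sectionPoint φ (a i) (b i)) ≤
      U ⊓ LinearMap.ker φ := by
    rw [Submodule.span_le]
    rintro _ ⟨i, rfl⟩
    exact ⟨U.sub_mem (U.smul_mem _ (hmem i i.2).1) (U.smul_mem _ (hmem i i.2).2),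
      apply_sectionPoint φ _ _⟩
  have h3 := Submodule.finrank_mono h2
  have h4 := finrank_span_eq_card hli
  simp only [Finset.coe_sort_coe, Fintype.card_coe] at h4
  simp only [Finset.coe_sort_coe] at h3
  omega

section Point

variable {V : Type*} [AddCommGroup V] [Module ℝ V]

/-- The functional `(α, -c) ↦ α p - c`, evaluating equations at the point `p`. -/
def evalEquation (p : V) : Dual ℝ (Dual ℝ V × ℝ) :=
  (Dual.eval ℝ V p).coprod LinearMap.id

theorem evalEquation_apply (p : V) (v : Dual ℝ V × ℝ) : evalEquation p v = v.1 p + v.2 := by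
  simp [evalEquation]

/-- An affine function vanishing at `p` is determined by its linear part. -/
theorem linearIndepOn_fst_sectionPoint_iff {ι : Type*} (p : V) (u v : ι → Dual ℝ V × ℝ)
    (I : Set ι) :
    LinearIndepOn ℝ (fun i => (sectionPoint (evalEquation p) (u i) (v i)).1) I ↔
      LinearIndepOn ℝ (fun i => sectionPoint (evalEquation p) (u i) (v i)) I := by
  refine LinearMap.linearIndepOn_iff_of_injOn (s := I)
    (v := fun i => sectionPoint (evalEquation p) (u i) (v i)) (LinearMap.fst ℝ (Dual ℝ V) ℝ) ?_
  have hle : Submodule.span ℝ ((fun i => sectionPoint (evalEquation p) (u i) (v i)) '' I) ≤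
      LinearMap.ker (evalEquation p) := by
    rw [Submodule.span_le]
    rintro _ ⟨i, _, rfl⟩
    exact apply_sectionPoint _ _ _
  intro x hx y hy hxy
  have hx' : evalEquation p x = 0 := hle hx
  have hy' : evalEquation p y = 0 := hle hy
  rw [evalEquation_apply] at hx' hy'
  have hxy' : x.1 = y.1 := hxy
  rw [hxy'] at hx'
  exact Prod.ext hxy' (by linarith)

/-- Every functional on `V* × ℝ` not vanishing at `(0, 1)` is a multiple of the evaluation at a
point of `V`. -/
theorem exists_eq_smul_evalEquation [FiniteDimensional ℝ V] (φ : Dual ℝ (Dual ℝ V × ℝ))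
    (hφ : φ (0, 1) ≠ 0) : ∃ p : V, φ = φ (0, 1) • evalEquation p := by
  refine ⟨(evalEquiv ℝ V).symm ((φ (0, 1))⁻¹ • φ ∘ₗ LinearMap.inl ℝ (Dual ℝ V) ℝ), ?_⟩
  refine LinearMap.ext fun v => ?_
  rw [LinearMap.smul_apply, evalEquation_apply, apply_evalEquiv_symm_apply]
  have hv : v = (v.1, 0) + v.2 • ((0, 1) : Dual ℝ V × ℝ) := by ext <;> simp
  conv_lhs => rw [hv, map_add, map_smul]
  simp
  field_simp

/-- Rows of a real matrix are independent if and only if their Gram determinant is nonzero. -/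
theorem linearIndependent_row_iff_det_mul_transpose_ne_zero {m n : Type*} [Fintype m]
    [DecidableEq m] [Fintype n] (A : Matrix m n ℝ) :
    LinearIndependent ℝ A.row ↔ (A * A.transpose).det ≠ 0 := by
  rw [← isUnit_iff_ne_zero, ← Matrix.isUnit_iff_isUnit_det,
    ← Matrix.linearIndependent_rows_iff_isUnit, linearIndependent_iff_card_eq_finrank_span,
    linearIndependent_iff_card_eq_finrank_span, Set.finrank, Set.finrank,
    ← Matrix.rank_eq_finrank_span_row, ← Matrix.rank_eq_finrank_span_row,
    Matrix.rank_self_mul_transpose]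

/-- The polynomial in the coordinates of `p` whose value is `α p - c`, for `v = (α, -c)`. -/
noncomputable def equationPolynomial {d : ℕ} (b : Basis (Fin d) ℝ V) (v : Dual ℝ V × ℝ) :
    MvPolynomial (Fin d) ℝ :=
  ∑ i, MvPolynomial.C (v.1 (b i)) * MvPolynomial.X i + MvPolynomial.C v.2

theorem eval_equationPolynomial {d : ℕ} (b : Basis (Fin d) ℝ V) (v : Dual ℝ V × ℝ) (p : V) :
    MvPolynomial.eval (fun i => b.repr p i) (equationPolynomial b v) = evalEquation p v := by
  have h : v.1 p = ∑ i, b.repr p i * v.1 (b i) := by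
    conv_lhs => rw [← b.sum_repr p]
    simp only [map_sum, map_smul, smul_eq_mul]
  rw [evalEquation_apply, equationPolynomial, h]
  simp [mul_comm]

/-- Independence of section points is an open condition on `p` in the Zariski topology. -/
theorem exists_mvPolynomial_linearIndepOn_iff {ι : Type*} {d : ℕ} (b : Basis (Fin d) ℝ V)
    (u v : ι → Dual ℝ V × ℝ) (I : Finset ι) :
    ∃ f : MvPolynomial (Fin d) ℝ, ∀ p : V, MvPolynomial.eval (fun i => b.repr p i) f ≠ 0 ↔
      LinearIndepOn ℝ (fun i => (sectionPoint (evalEquation p) (u i) (v i)).1) (I : Set ι) := by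
  classical
  let P := equationPolynomial b
  let A : Matrix I (Fin d) (MvPolynomial (Fin d) ℝ) := Matrix.of fun i j =>
    P (v i) * MvPolynomial.C ((u i).1 (b j)) - P (u i) * MvPolynomial.C ((v i).1 (b j))
  refine ⟨(A * A.transpose).det, fun p => ?_⟩
  let φ : (Dual ℝ V) →ₗ[ℝ] (Fin d → ℝ) := (b.constr ℝ).symm.toLinearMap
  have hrow : (A.map (MvPolynomial.eval fun i => b.repr p i)).row =
      φ ∘ fun i : I => (sectionPoint (evalEquation p) (u i) (v i)).1 := by
    funext i j
    simp [A, P, φ, eval_equationPolynomial, sectionPoint, Basis.constr, Matrix.row]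
  have hφ : LinearMap.ker φ = ⊥ := LinearEquiv.ker _
  have hli := φ.linearIndependent_iff hφ
    (v := fun i : I => (sectionPoint (evalEquation p) (u i) (v i)).1)
  rw [RingHom.map_det, RingHom.mapMatrix_apply, Matrix.map_mul, Matrix.transpose_map,
    ← linearIndependent_row_iff_det_mul_transpose_ne_zero, hrow, hli]
  rfl

end Point

/-! ### The hyperplanes of the valid order arrangement -/

section Hyperplane

variable {V : Type*} [AddCommGroup V] [Module ℝ V]

theorem exists_eq_smul_of_ker_le {α α' : Dual ℝ V} (h : LinearMap.ker α ≤ LinearMap.ker α') :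
    ∃ t : ℝ, α' = t • α := by
  have h1 : α' ∈ Submodule.span ℝ (Set.range fun _ : Unit => α) :=
    mem_span_of_iInf_ker_le_ker (by simpa using h)
  rw [Set.range_const, Submodule.mem_span_singleton] at h1
  exact h1.imp fun _ => Eq.symm

theorem ker_smul_eq {α : Dual ℝ V} {t : ℝ} (ht : t ≠ 0) :
    LinearMap.ker (t • α) = LinearMap.ker α :=
  LinearMap.ker_smul α t ht

theorem ker_eq_of_ker_le {α α' : Dual ℝ V} (hα' : α' ≠ 0)
    (h : LinearMap.ker α ≤ LinearMap.ker α') : LinearMap.ker α = LinearMap.ker α' := by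
  obtain ⟨t, rfl⟩ := exists_eq_smul_of_ker_le h
  exact (ker_smul_eq fun ht => hα' (by simp [ht])).symm

theorem exists_apply_eq {α : Dual ℝ V} (hα : α ≠ 0) (c : ℝ) : ∃ x, α x = c :=
  LinearMap.surjective hα c

variable {H H' : AffineSubspace ℝ V} {α α' : Dual ℝ V} {c c' : ℝ}

theorem direction_eq_ker (hα : α ≠ 0) (hH : (H : Set V) = {x | α x = c}) :
    H.direction = LinearMap.ker α := by
  obtain ⟨x, hx⟩ := exists_apply_eq hα c
  have : H = AffineSubspace.mk' x (LinearMap.ker α) := by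
    refine SetLike.coe_injective (hH.trans ?_)
    ext y
    simp [AffineSubspace.mem_mk', hx, sub_eq_zero]
  rw [this, AffineSubspace.direction_mk']

theorem parallel_iff_ker_eq (hα : α ≠ 0) (hH : (H : Set V) = {x | α x = c}) (hα' : α' ≠ 0)
    (hH' : (H' : Set V) = {x | α' x = c'}) :
    H.Parallel H' ↔ LinearMap.ker α = LinearMap.ker α' := by
  have hbot : ∀ {K : AffineSubspace ℝ V} {β : Dual ℝ V} {a : ℝ}, β ≠ 0 →
      (K : Set V) = {x | β x = a} → K ≠ ⊥ := fun hβ hK => by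
    rw [← AffineSubspace.nonempty_iff_ne_bot, hK]
    exact exists_apply_eq hβ _
  rw [AffineSubspace.parallel_iff_direction_eq_and_eq_bot_iff_eq_bot, direction_eq_ker hα hH,
    direction_eq_ker hα' hH']
  simp [hbot hα hH, hbot hα' hH']

/-- The combination of two equations that vanishes at `p` defines the span of `p` and the
intersection of the two hyperplanes. -/
theorem affineSpan_insert_inter_eq {p : V} (hα : α ≠ 0) (hα' : α' ≠ 0)
    (hker : LinearMap.ker α ≠ LinearMap.ker α') (hp : α p ≠ c) :
    affineSpan ℝ (insert p ({x | α x = c} ∩ {x | α' x = c'})) =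
      AffineSubspace.mk' p (LinearMap.ker ((α' p - c') • α - (α p - c) • α')) := by
  obtain ⟨x, hx, hx'⟩ : ∃ x, α x = c ∧ α' x = c' := by
    obtain ⟨u, hu, hu'⟩ : ∃ u, α u = 0 ∧ α' u ≠ 0 := by
      by_contra! hcon
      exact hker (ker_eq_of_ker_le hα' hcon)
    obtain ⟨x, hx⟩ := exists_apply_eq hα c
    refine ⟨x + ((c' - α' x) / α' u) • u, by simp [hx, hu], ?_⟩
    rw [map_add, map_smul, smul_eq_mul, div_mul_cancel₀ _ hu']
    ring
  have hmem : ∀ y, y ∈ AffineSubspace.mk' p (LinearMap.ker ((α' p - c') • α - (α p - c) • α')) ↔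
      (α' p - c') * (α y - α p) - (α p - c) * (α' y - α' p) = 0 := by
    intro y
    simp [AffineSubspace.mem_mk']
  refine le_antisymm (affineSpan_le.2 (Set.insert_subset ?_ ?_)) fun y hy => ?_
  · exact AffineSubspace.self_mem_mk' _ _
  · rintro y ⟨hy, hy'⟩
    rw [Set.mem_ofPred_eq] at hy hy'
    rw [SetLike.mem_coe, hmem, hy, hy']
    ring
  · rw [hmem] at hy
    have hp' : α p - c ≠ 0 := sub_ne_zero.2 hp
    -- `y - p` is a multiple of `x - p` up to a vector `u` parallel to both hyperplanes
    let τ := (α p - α y) / (α p - c)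
    have hτ : τ * (α p - c) = α p - α y := div_mul_cancel₀ _ hp'
    let u := y - p - τ • (x - p)
    have hu : α u = 0 := by
      simp only [u, map_sub, map_smul, smul_eq_mul, hx]
      linear_combination hτ
    have hu' : α' u = 0 := by
      simp only [u, map_sub, map_smul, smul_eq_mul, hx']
      refine (mul_eq_zero.1 ?_).resolve_left hp'
      linear_combination (α' p - c') * hτ - hy
    set S := affineSpan ℝ (insert p ({x | α x = c} ∩ {x | α' x = c'}))
    have hpS : p ∈ S := subset_affineSpan _ _ (Set.mem_insert _ _)
    have hxS : x ∈ S := subset_affineSpan _ _ (Set.mem_insert_of_mem _ ⟨hx, hx'⟩)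
    have hxuS : x + u ∈ S :=
      subset_affineSpan _ _ (Set.mem_insert_of_mem _ ⟨by simp [hx, hu], by simp [hx', hu']⟩)
    have hdir : y - p ∈ S.direction := by
      have h1 := S.direction.smul_mem τ (AffineSubspace.vsub_mem_direction hxS hpS)
      have h2 := AffineSubspace.vsub_mem_direction hxuS hxS
      have h3 := S.direction.add_mem h1 h2
      rw [vsub_eq_sub, vsub_eq_sub, add_sub_cancel_left] at h3
      rwa [show τ • (x - p) + u = y - p from add_sub_cancel _ _] at h3
    simpa using AffineSubspace.vadd_mem_of_mem_direction hdir hpS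

/-- The combination of the equations of two distinct parallel hyperplanes that vanishes at `p`
defines the parallel hyperplane through `p`. -/
theorem ker_smul_sub_smul_eq_of_ker_eq {p : V} (hα' : α' ≠ 0)
    (hker : LinearMap.ker α = LinearMap.ker α') (hne : {x | α x = c} ≠ {x | α' x = c'}) :
    LinearMap.ker ((α' p - c') • α - (α p - c) • α') = LinearMap.ker α := by
  obtain ⟨t, rfl⟩ := exists_eq_smul_of_ker_le hker.le
  have ht : t ≠ 0 := fun h => hα' (by simp [h])
  have hc : t * c - c' ≠ 0 := by
    refine fun h => hne ?_
    ext x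
    simp [← sub_eq_zero.1 h, ht]
  have : ((t • α) p - c') • α - (α p - c) • t • α = (t * c - c') • α := by
    rw [LinearMap.smul_apply, smul_eq_mul]
    module
  rw [this, ker_smul_eq hc]

/-- The hyperplane through `p` whose linear part is that of the combination, vanishing at `p`, of
the equations `u` and `v`. -/
noncomputable def sectionHyperplane (p : V) (u v : Dual ℝ V × ℝ) : AffineSubspace ℝ V :=
  AffineSubspace.mk' p (LinearMap.ker (sectionPoint (evalEquation p) u v).1)

theorem sectionHyperplane_comm (p : V) (u v : Dual ℝ V × ℝ) :
    sectionHyperplane p u v = sectionHyperplane p v u := by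
  have : (sectionPoint (evalEquation p) u v).1 = -(sectionPoint (evalEquation p) v u).1 := by
    simp [sectionPoint]
  rw [sectionHyperplane, sectionHyperplane, this, LinearMap.ker_neg]

/-- The hyperplanes of the valid order arrangement in a uniform description: whether `H` and `H'`
are parallel or not, the combination of their equations vanishing at `p` is an equation. -/
theorem validOrderArrangement_eq {𝒜 : Set (AffineSubspace ℝ V)} (h𝒜 : ∀ H ∈ 𝒜, IsHyperplane H)
    {p : V} (hp : ∀ H ∈ 𝒜, p ∉ H) :
    validOrderArrangement 𝒜 p = {K | ∃ H ∈ 𝒜, ∃ H' ∈ 𝒜, H ≠ H' ∧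
      K = sectionHyperplane p (equationVector H) (equationVector H')} := by
  have key : ∀ H ∈ 𝒜, ∀ H' ∈ 𝒜,
      (¬ H.Parallel H' → affineSpan ℝ (insert p ((H : Set V) ∩ (H' : Set V))) =
        sectionHyperplane p (equationVector H) (equationVector H')) ∧
      (H ≠ H' → H.Parallel H' → AffineSubspace.mk' p H.direction =
        sectionHyperplane p (equationVector H) (equationVector H')) := by
    intro H hH H' hH'
    obtain ⟨α, c, hα, hαc, hv⟩ := isEquationVector_equationVector (h𝒜 H hH)
    obtain ⟨α', c', hα', hαc', hv'⟩ := isEquationVector_equationVector (h𝒜 H' hH')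
    have hpc : α p ≠ c := fun h => hp H hH (by rw [← SetLike.mem_coe, hαc]; exact h)
    have hsec : (sectionPoint (evalEquation p) (equationVector H) (equationVector H')).1 =
        (α' p - c') • α - (α p - c) • α' := by
      simp [sectionPoint, evalEquation_apply, hv, hv', sub_eq_add_neg]
    rw [sectionHyperplane, hsec, parallel_iff_ker_eq hα hαc hα' hαc', direction_eq_ker hα hαc]
    refine ⟨fun hker => ?_, fun hne hker => ?_⟩
    · rw [hαc, hαc', affineSpan_insert_inter_eq hα hα' hker hpc]
    · rw [ker_smul_sub_smul_eq_of_ker_eq hα' hker]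
      rw [← hαc, ← hαc']
      exact fun h => hne (SetLike.coe_injective h)
  ext K
  constructor
  · rintro (⟨H, hH, H', hH', hpar, rfl⟩ | ⟨H, hH, H', hH', hne, hpar, rfl⟩)
    · refine ⟨H, hH, H', hH', ?_, (key H hH H' hH').1 hpar⟩
      rintro rfl
      exact hpar (AffineSubspace.Parallel.refl H)
    · exact ⟨H, hH, H', hH', hne, (key H hH H' hH').2 hne hpar⟩
  · rintro ⟨H, hH, H', hH', hne, rfl⟩
    by_cases hpar : H.Parallel H'
    · exact Or.inr ⟨H, hH, H', hH', hne, hpar, ((key H hH H' hH').2 hne hpar).symm⟩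
    · exact Or.inl ⟨H, hH, H', hH', hpar, ((key H hH H' hH').1 hpar).symm⟩

theorem equationVector_injOn {𝒜 : Set (AffineSubspace ℝ V)} (h𝒜 : ∀ H ∈ 𝒜, IsHyperplane H) :
    Set.InjOn equationVector 𝒜 := by
  intro H hH H' hH' heq
  obtain ⟨α, c, _, hαc, hv⟩ := isEquationVector_equationVector (h𝒜 H hH)
  obtain ⟨α', c', _, hαc', hv'⟩ := isEquationVector_equationVector (h𝒜 H' hH')
  rw [hv, hv', Prod.mk.injEq, neg_inj] at heq
  exact SetLike.coe_injective (by rw [hαc, hαc', heq.1, heq.2])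

theorem evalEquation_equationVector_ne_zero {H : AffineSubspace ℝ V} (hH : IsHyperplane H) {p : V}
    (hp : p ∉ H) : evalEquation p (equationVector H) ≠ 0 := by
  obtain ⟨α, c, _, hαc, hv⟩ := isEquationVector_equationVector hH
  rw [evalEquation_apply, hv, ← sub_eq_add_neg, sub_ne_zero]
  exact fun h => hp (by rw [← SetLike.mem_coe, hαc]; exact h)

end Hyperplane

/-! ### Generic representation of the Dilworth truncation -/

/-- The rank condition of `DilworthIndep` for a matroid of vectors, in terms of spans. -/
theorem dilworthIndep_vectorMatroid_iff {K W : Type*} [Field K] [AddCommGroup W] [Module K W]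
    {E : Set W} {I : Set (Finset W)} (hI : I ⊆ {s : Finset W | (s : Set W) ⊆ E ∧ s.card = 2}) :
    DilworthIndep (vectorMatroid K E) 1 I ↔
      ∀ S : Finset (Finset W), (S : Set (Finset W)) ⊆ I → S.Nonempty →
        S.card + 1 ≤ finrank K (Submodule.span K (⋃ s ∈ S, (s : Set W))) := by
  refine (and_iff_right hI).trans ?_
  refine forall_congr' fun S => forall_congr' fun hS => forall_congr' fun _ => ?_
  rw [(isRepresentation_vectorMatroid E).eRk_eq_finrank, Set.image_id, Nat.cast_le]
  · exact Set.iUnion₂_subset fun s hs => (hI (hS hs)).1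
  · exact S.finite_toSet.biUnion fun s _ => s.finite_toSet

/-- For `p` outside the zero set of a nonzero polynomial, the points in which the hyperplane
`evalEquation p = 0` meets the lines spanned by the pairs of vectors in `E`, projected to `V*`,
represent the first Dilworth truncation. Here `x s` and `y s` are the two elements of `s`. -/
theorem exists_mvPolynomial_isRepresentation {V : Type*} [AddCommGroup V] [Module ℝ V] {d : ℕ}
    (b : Basis (Fin d) ℝ V) {E : Set (Dual ℝ V × ℝ)} (hE : E.Finite)
    {x y : Finset (Dual ℝ V × ℝ) → Dual ℝ V × ℝ}
    (hxy : ∀ s : Finset (Dual ℝ V × ℝ), s.card = 2 → (s : Set (Dual ℝ V × ℝ)) = {x s, y s}) :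
    ∃ f : MvPolynomial (Fin d) ℝ, f ≠ 0 ∧
      ∀ p : V, (∀ v ∈ E, evalEquation p v ≠ 0) →
        MvPolynomial.eval (fun i => b.repr p i) f ≠ 0 →
          IsRepresentation ℝ (dilworthTruncation 1 (vectorMatroid ℝ E))
            fun s => (sectionPoint (evalEquation p) (x s) (y s)).1 := by
  classical
  have := b.finiteDimensional_of_finite
  let G : Set (Finset (Dual ℝ V × ℝ)) := {s | (s : Set (Dual ℝ V × ℝ)) ⊆ E ∧ s.card = 2}
  have hGfin : G.Finite := by
    refine (Finset.finite_toSet hE.toFinset.powerset).subset fun s hs => ?_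
    rw [Finset.mem_coe, Finset.mem_powerset]
    exact fun v hv => hE.mem_toFinset.2 (hs.1 hv)
  have hUnion : ∀ S : Finset (Finset (Dual ℝ V × ℝ)), (S : Set _) ⊆ G →
      (⋃ s ∈ S, (s : Set (Dual ℝ V × ℝ))) = ⋃ s ∈ S, {x s, y s} := fun S hS =>
    Set.iUnion₂_congr fun s hs => hxy s (hS hs).2
  choose f hf using exists_mvPolynomial_linearIndepOn_iff b x y
  -- the independent sets of the truncation; each contributes one factor of the polynomial
  let 𝓘 : Finset (Finset (Finset (Dual ℝ V × ℝ))) :=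
    hGfin.toFinset.powerset.filter fun I => DilworthIndep (vectorMatroid ℝ E) 1 (I : Set _)
  have h𝓘 : ∀ I : Finset (Finset (Dual ℝ V × ℝ)),
      I ∈ 𝓘 ↔ (I : Set _) ⊆ G ∧ DilworthIndep (vectorMatroid ℝ E) 1 (I : Set _) := by
    intro I
    simp only [𝓘, Finset.mem_filter, Finset.mem_powerset]
    rw [← Finset.coe_subset, hGfin.coe_toFinset]
  refine ⟨∏ I ∈ 𝓘, f I, Finset.prod_ne_zero_iff.2 fun I hI => ?_, fun p hp hfp I => ?_⟩
  · obtain ⟨hIG, hI⟩ := (h𝓘 I).1 hI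
    rw [dilworthIndep_vectorMatroid_iff hIG] at hI
    obtain ⟨φ, hφ, hli⟩ := exists_functional_linearIndepOn (K := ℝ) I x y {(0, 1)}
      (Set.finite_singleton _) (by simp) fun S hS hne => by
        rw [← hUnion S ((Finset.coe_subset.2 hS).trans hIG)]
        exact hI S (Finset.coe_subset.2 hS) hne
    -- `φ (0, 1) ≠ 0` puts the generic functional into the affine chart `V` of evaluations
    obtain ⟨p, hp⟩ := exists_eq_smul_evalEquation φ (hφ _ rfl)
    have hli' : LinearIndepOn ℝ (fun s => sectionPoint (evalEquation p) (x s) (y s))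
        (I : Set (Finset (Dual ℝ V × ℝ))) := by
      refine LinearIndependent.of_comp (φ (0, 1) • LinearMap.id) ?_
      have hsmul : ∀ s, φ (0, 1) • sectionPoint (evalEquation p) (x s) (y s) =
          sectionPoint φ (x s) (y s) := fun s => by
        conv_rhs => rw [hp]
        simp [sectionPoint, smul_sub, smul_smul]
      exact (linearIndepOn_congr fun s _ => hsmul s).2 hli
    have := (hf I p).2 ((linearIndepOn_fst_sectionPoint_iff p x y _).2 hli')
    intro h0
    simp [h0] at this
  · rw [dilworthTruncation_indep_iff]
    change _ ↔ I ⊆ G ∧ _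
    refine ⟨fun hI => ⟨hI.1, ?_⟩, fun ⟨hIG, hI⟩ => ?_⟩
    · obtain ⟨J, rfl⟩ := (hGfin.subset hI.1).exists_finset_coe
      rw [map_prod, Finset.prod_ne_zero_iff] at hfp
      exact (hf J p).1 (hfp J ((h𝓘 J).2 ⟨hI.1, hI⟩))
    · rw [dilworthIndep_vectorMatroid_iff hIG]
      intro S hS hne
      rw [hUnion S (hS.trans hIG)]
      refine card_add_one_le_finrank_of_linearIndepOn (φ := evalEquation p) hne (fun s hs => ?_) ?_
      · obtain ⟨hsE, hs2⟩ := hIG (hS hs)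
        rw [hxy s hs2] at hsE
        exact hp _ (hsE (by simp))
      · exact (linearIndepOn_fst_sectionPoint_iff p x y _).1 (hI.mono hS)

end ValidOrder

open ValidOrder in
theorem mainTheorem1 {V : Type*} [AddCommGroup V] [Module ℝ V] {d : ℕ}
    (b : Module.Basis (Fin d) ℝ V) (𝒜 : Set (AffineSubspace ℝ V)) (hfin : 𝒜.Finite)
    (h𝒜 : ∀ H ∈ 𝒜, ValidOrder.IsHyperplane H) :
    ∃ f : MvPolynomial (Fin d) ℝ, f ≠ 0 ∧
      ∀ p : V, (∀ H ∈ 𝒜, p ∉ H) → MvPolynomial.eval (fun i => b.repr p i) f ≠ 0 →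
        Nonempty (ValidOrder.IntersectionLattice (ValidOrder.validOrderArrangement 𝒜 p) ≃o
          ValidOrder.FlatLattice
            (ValidOrder.dilworthTruncation 1 (ValidOrder.arrangementMatroid 𝒜))) := by
  classical
  have := b.finiteDimensional_of_finite
  -- an ordering of each pair; the choice affects an equation only by a sign
  have hpair : ∀ s : Finset (Module.Dual ℝ V × ℝ), ∃ u v, s.card = 2 → u ≠ v ∧ s = {u, v} := by
    intro s
    by_cases hs : s.card = 2
    · obtain ⟨u, v, h⟩ := Finset.card_eq_two.1 hs
      exact ⟨u, v, fun _ => h⟩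
    · exact ⟨0, 0, fun h => absurd h hs⟩
  choose x y hxy using hpair
  obtain ⟨f, hf0, hf⟩ := exists_mvPolynomial_isRepresentation b
    (E := equationVector '' 𝒜) (hfin.image _) (x := x) (y := y)
    fun s hs => by
      rw [← Finset.coe_pair, ← (hxy s hs).2]
  refine ⟨f, hf0, fun p hp hfp => ?_⟩
  have hrep := hf p (by
    rintro _ ⟨H, hH, rfl⟩
    exact evalEquation_equationVector_ne_zero (h𝒜 H hH) (hp H hH)) hfp
  have hvo : validOrderArrangement 𝒜 p = (fun s => sectionHyperplane p (x s) (y s)) ''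
      (dilworthTruncation 1 (arrangementMatroid 𝒜)).E := by
    rw [validOrderArrangement_eq h𝒜 hp, dilworthTruncation_ground]
    ext K
    constructor
    · rintro ⟨H, hH, H', hH', hne, rfl⟩
      have hne' := (equationVector_injOn h𝒜).ne hH hH' hne
      have hcard := Finset.card_pair hne'
      refine ⟨{equationVector H, equationVector H'}, ⟨?_, hcard⟩, ?_⟩
      · rw [Finset.coe_pair, Set.insert_subset_iff, Set.singleton_subset_iff]
        exact ⟨⟨H, hH, rfl⟩, ⟨H', hH', rfl⟩⟩
      · have h := (hxy _ hcard).2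
        rw [← Finset.coe_inj, Finset.coe_pair, Finset.coe_pair, Set.pair_eq_pair_iff] at h
        dsimp only
        obtain ⟨h1, h2⟩ | ⟨h1, h2⟩ := h
        · rw [← h1, ← h2]
        · rw [← h1, ← h2, sectionHyperplane_comm]
    · rintro ⟨s, ⟨hsE, hs⟩, rfl⟩
      obtain ⟨hne, h⟩ := hxy s hs
      rw [h, Finset.coe_pair, Set.insert_subset_iff, Set.singleton_subset_iff] at hsE
      obtain ⟨⟨H, hH, h1⟩, H', hH', h2⟩ := hsE
      refine ⟨H, hH, H', hH', ?_, by rw [h1, h2]⟩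
      rintro rfl
      exact hne (h1.symm.trans h2)
  rw [hvo]
  exact hrep.nonempty_intersectionLattice_orderIso p
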